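/- Let $\Omega\subset\mathbb R^d$ be a bounded open set with Lipschitz boundary, let $\Gamma_D,\Gamma_C\subseteq\partial\Omega$ be measurable, and let $n$ be the outer unit normal. Let $V=\{v\in H^1(\Omega)^d:\ v=0\text{ on }\Gamma_D,\ v\cdot n=0\text{ on }\Gamma_C\}$ with the norm of $H^1(\Omega)^d$, let $X=L^2(\Gamma_C)$, and let $\gamma\colon V\to X^d$ be the trace map, with operator norm $\|\gamma\|$. Let $A\colon\mathbb R\to\mathbb R$ be nondecreasing and continuous, let $f\colon[0,\infty)\to\mathbb R$ be Lipschitz with constant $L_f$, and let $T>0$ and $\alpha_0\in X$. For a rate $\dot u\in L^2(0,T;V)$, a solution of the state problem is a function $\alpha\in C([0,T];X)$ with $\alpha(0)=\alpha_0$ that is absolutely continuous on every compact subinterval of $(0,T)$, with derivative $\dot\alpha$ (so that $\alpha(t)-\alpha(s)=\int_s^t\dot\alpha\,dr$), and satisfies, for almost every $t\in[0,T]$, $$\dot\alpha(t)+A(\alpha(t))=f(|\gamma\dot u(t)|)\quad\text{almost everywhere on }\Gamma_C.$$ Let $\alpha$ and $\beta$ be solutions of the state problem for the rates $\dot u$ and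 $\dot w\in L^2(0,T;V)$, respectively, with the same initial state $\alpha_0$. Then $\alpha$ and $\beta$ have pointwise representatives for which $\alpha(\cdot,x)$ and $\beta(\cdot,x)$ are continuous on $[0,T]$ for almost every $x\in\Gamma_C$; $\gamma\dot u$ and $\gamma\dot w$ have jointly measurable representatives; and for any such representatives, for almost every $x\in\Gamma_C$ and all $t\in[0,T]$, $$\|\alpha(\cdot,x)-\beta(\cdot,x)\|_{C([0,t])}\le L_f\,\|\gamma\dot u(\cdot,x)-\gamma\dot w(\cdot,x)\|_{L^1(0,t;\mathbb R^d)},$$ where the right-hand side is finite. Moreover, $$\|\alpha-\beta\|_{C([0,T];X)}\le\sqrt T\,L_f\,\|\gamma\dot u-\gamma\dot w\|_{L^2(0,T;X^d)}.$$ In particular, any solution operator $S\colon\dot u\mapsto\alpha$ (that is, any map that sends each rate in its domain, which may be any subset of $L^2(0,T;V)$, to a solution of the state problem with initial state $\alpha_0$) is Lipschitz with constant $L_S=\sqrt T\,\|\gamma\|\,L_f$ from $L^2(0,T;V)$ to $C([0,T];X)$. -/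

import Mathlib

open MeasureTheory Set
open scoped NNReal ENNReal ContDiff InnerProductSpace

noncomputable section

namespace RateState

/-- The Euclidean space `ℝ^d`. -/
abbrev Eucl (d : ℕ) : Type := EuclideanSpace ℝ (Fin d)

/-- `d × d` matrices with the Frobenius norm. -/
abbrev Mat (d : ℕ) : Type := EuclideanSpace ℝ (Fin d × Fin d)

variable {d : ℕ}

/-- `Ω` has a Lipschitz boundary: near each of its boundary points, `Ω` is, in a suitable
direction `e`, the set of points strictly below the graph of a Lipschitz function. -/
def HasLipschitzBoundary (Ω : Set (Eucl d)) : Prop :=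
  ∀ x ∈ frontier Ω, ∃ (U : Set (Eucl d)) (e : Eucl d) (K : ℝ≥0) (h : (ℝ ∙ e)ᗮ → ℝ),
    IsOpen U ∧ x ∈ U ∧ ‖e‖ = 1 ∧ LipschitzWith K h ∧
      ∀ y ∈ U, (y ∈ Ω ↔ ⟪y, e⟫_ℝ < h ((ℝ ∙ e)ᗮ.orthogonalProjectionOnto y))

/-- The surface measure on the boundary `Γ = ∂Ω`: the (Euclidean normalised)
`(d-1)`-dimensional Hausdorff measure. (For `d = 0` every boundary is empty.) -/
def surfaceMeasure (Ω : Set (Eucl d)) : Measure (Eucl d) :=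
  (Measure.euclideanHausdorffMeasure (d - 1)).restrict (frontier Ω)

/-- The surface measure on the boundary segment `ΓC ⊆ ∂Ω`. -/
def segmentMeasure (Ω ΓC : Set (Eucl d)) : Measure (Eucl d) :=
  (surfaceMeasure Ω).restrict ΓC

/-- `n` is the outer unit normal of `Ω` at `x`: to first order at `x`, `Ω` is the half space
`{y | ⟪y - x, n⟫ < 0}`. -/
def IsOuterNormal (Ω : Set (Eucl d)) (x n : Eucl d) : Prop :=
  ‖n‖ = 1 ∧ ∀ ε > 0, ∃ r > 0, ∀ y, ‖y - x‖ < r →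
    (⟪y - x, n⟫_ℝ < -(ε * ‖y - x‖) → y ∈ Ω) ∧ (ε * ‖y - x‖ < ⟪y - x, n⟫_ℝ → y ∉ Ω)

open Classical in
/-- The outer unit normal field. For a Lipschitz boundary, the outer unit normal exists at almost
every boundary point, and it is unique wherever it exists. -/
def outerNormal (Ω : Set (Eucl d)) (x : Eucl d) : Eucl d :=
  if h : ∃ n, IsOuterNormal Ω x n then h.choose else 0

/-- `L²(Ω)^d × L²(Ω)^{d × d}` with the Hilbert space norm. -/
abbrev L2Pair (Ω : Set (Eucl d)) : Type :=
  WithLp 2 (Lp (Eucl d) 2 (volume.restrict Ω) × Lp (Mat d) 2 (volume.restrict Ω))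

instance (Ω : Set (Eucl d)) : NormedAddCommGroup (L2Pair Ω) :=
  WithLp.instProdNormedAddCommGroup 2 _ _

instance (Ω : Set (Eucl d)) : NormedSpace ℝ (L2Pair Ω) :=
  WithLp.instProdNormedSpace 2 ℝ _ _

/-- `G` is the weak gradient of `v` on `Ω`, i.e. `G i j = ∂ⱼ vᵢ` in the sense of distributions. -/
def IsWeakGradient (Ω : Set (Eucl d)) (v : Eucl d → Eucl d) (G : Eucl d → Mat d) : Prop :=
  ∀ φ : Eucl d → ℝ, ContDiff ℝ ∞ φ → HasCompactSupport φ → tsupport φ ⊆ Ω → ∀ i j : Fin d,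
    ∫ x in Ω, v x i * fderiv ℝ φ x (EuclideanSpace.single j 1) = -∫ x in Ω, G x (i, j) * φ x

theorem integrable_coord_mul {ι : Type*} [Fintype ι] {μ : Measure (Eucl d)}
    [IsFiniteMeasureOnCompacts μ] (v : Lp (EuclideanSpace ℝ ι) 2 μ) (i : ι)
    {ψ : Eucl d → ℝ} (hψ : Continuous ψ) (hc : HasCompactSupport ψ) :
    Integrable (fun x => v x i * ψ x) μ := by
  have h1 : MemLp (fun x => v x i) 2 μ :=
    (EuclideanSpace.proj (𝕜 := ℝ) i).comp_memLp v
  exact h1.integrable_mul (q := 2) (hψ.memLp_of_hasCompactSupport hc)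

/-- The Sobolev space `H¹(Ω)^d`, as the space of pairs `(v, ∇v)` in `L²(Ω)^d × L²(Ω)^{d × d}`
with the norm `‖v‖² = ∫_Ω |v|² + |∇v|²`. -/
def H1 (Ω : Set (Eucl d)) : Submodule ℝ (L2Pair Ω) where
  carrier := {p | IsWeakGradient Ω p.fst p.snd}
  add_mem' := by
    intro p q hp hq φ h1 h2 h3 i j
    have hd : Continuous fun x => fderiv ℝ φ x (EuclideanSpace.single j 1) :=
      (h1.continuous_fderiv (by simp)).clm_apply continuous_const
    have hdc : HasCompactSupport fun x => fderiv ℝ φ x (EuclideanSpace.single j 1) :=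
      (h2.fderiv (𝕜 := ℝ)).comp_left (g := fun L : Eucl d →L[ℝ] ℝ =>
        L (EuclideanSpace.single j 1)) rfl
    have e1 : (fun x => (p + q).fst x i * fderiv ℝ φ x (EuclideanSpace.single j 1))
        =ᵐ[volume.restrict Ω] fun x => p.fst x i * fderiv ℝ φ x (EuclideanSpace.single j 1)
          + q.fst x i * fderiv ℝ φ x (EuclideanSpace.single j 1) := by
      filter_upwards [Lp.coeFn_add p.fst q.fst] with x hx
      rw [WithLp.add_fst, hx]
      simp [add_mul]
    have e2 : (fun x => (p + q).snd x (i, j) * φ x)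
        =ᵐ[volume.restrict Ω] fun x => p.snd x (i, j) * φ x + q.snd x (i, j) * φ x := by
      filter_upwards [Lp.coeFn_add p.snd q.snd] with x hx
      rw [WithLp.add_snd, hx]
      simp [add_mul]
    rw [integral_congr_ae e1, integral_congr_ae e2,
      integral_add (integrable_coord_mul _ _ hd hdc) (integrable_coord_mul _ _ hd hdc),
      integral_add (integrable_coord_mul _ _ h1.continuous h2)
        (integrable_coord_mul _ _ h1.continuous h2),
      hp φ h1 h2 h3 i j, hq φ h1 h2 h3 i j]
    ring
  zero_mem' := by
    intro φ h1 h2 h3 i j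
    have e1 : (fun x => (0 : L2Pair Ω).fst x i * fderiv ℝ φ x (EuclideanSpace.single j 1))
        =ᵐ[volume.restrict Ω] fun _ => 0 := by
      filter_upwards [Lp.coeFn_zero (Eucl d) 2 (volume.restrict Ω)] with x hx
      rw [WithLp.zero_fst, hx]
      simp
    have e2 : (fun x => (0 : L2Pair Ω).snd x (i, j) * φ x)
        =ᵐ[volume.restrict Ω] fun _ => 0 := by
      filter_upwards [Lp.coeFn_zero (Mat d) 2 (volume.restrict Ω)] with x hx
      rw [WithLp.zero_snd, hx]
      simp
    rw [integral_congr_ae e1, integral_congr_ae e2]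
    simp
  smul_mem' := by
    intro c p hp φ h1 h2 h3 i j
    have e1 : (fun x => (c • p).fst x i * fderiv ℝ φ x (EuclideanSpace.single j 1))
        =ᵐ[volume.restrict Ω]
          fun x => c * (p.fst x i * fderiv ℝ φ x (EuclideanSpace.single j 1)) := by
      filter_upwards [Lp.coeFn_smul c p.fst] with x hx
      rw [WithLp.smul_fst, hx]
      simp [mul_assoc]
    have e2 : (fun x => (c • p).snd x (i, j) * φ x)
        =ᵐ[volume.restrict Ω] fun x => c * (p.snd x (i, j) * φ x) := by
      filter_upwards [Lp.coeFn_smul c p.snd] with x hx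
      rw [WithLp.smul_snd, hx]
      simp [mul_assoc]
    rw [integral_congr_ae e1, integral_congr_ae e2, integral_const_mul, integral_const_mul,
      hp φ h1 h2 h3 i j]
    ring

instance (Ω : Set (Eucl d)) : NormedAddCommGroup (H1 Ω) := (H1 Ω).normedAddCommGroup

instance (Ω : Set (Eucl d)) : NormedSpace ℝ (H1 Ω) := (H1 Ω).normedSpace

/-- `γ` is a trace map `H¹(Ω)^d → L²(∂Ω)^d`: a bounded linear map that restricts (functions
which coincide on `Ω` with) smooth functions on `ℝ^d` to the boundary. -/
def IsTraceMap (Ω : Set (Eucl d)) (γ : H1 Ω →L[ℝ] Lp (Eucl d) 2 (surfaceMeasure Ω)) : Prop :=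
  ∀ (φ : Eucl d → Eucl d) (v : H1 Ω), ContDiff ℝ ∞ φ →
    (v : L2Pair Ω).fst =ᵐ[volume.restrict Ω] φ → γ v =ᵐ[surfaceMeasure Ω] φ

open Classical in
/-- The trace map `H¹(Ω)^d → L²(∂Ω)^d`. A bounded open set `Ω` with Lipschitz boundary has exactly
one trace map, since restrictions of smooth functions are then dense in `H¹(Ω)^d`. -/
def trace (Ω : Set (Eucl d)) : H1 Ω →L[ℝ] Lp (Eucl d) 2 (surfaceMeasure Ω) :=
  if h : ∃ γ, IsTraceMap Ω γ then h.choose else 0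

/-- The space `V` of all `v ∈ H¹(Ω)^d` with `v = 0` on `ΓD` and `v · n = 0` on `ΓC`, in the sense
of traces, with the norm of `H¹(Ω)^d`. -/
def V (Ω ΓD ΓC : Set (Eucl d)) : Submodule ℝ (H1 Ω) where
  carrier := {v | (∀ᵐ x ∂segmentMeasure Ω ΓD, trace Ω v x = 0) ∧
    ∀ᵐ x ∂segmentMeasure Ω ΓC, ⟪trace Ω v x, outerNormal Ω x⟫_ℝ = 0}
  add_mem' := by
    rintro v w ⟨hv, hv'⟩ ⟨hw, hw'⟩
    have h := Lp.coeFn_add (trace Ω v) (trace Ω w)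
    refine ⟨?_, ?_⟩
    · filter_upwards [hv, hw, ae_restrict_of_ae h] with x h1 h2 h3
      rw [map_add, h3, Pi.add_apply, h1, h2, add_zero]
    · filter_upwards [hv', hw', ae_restrict_of_ae h] with x h1 h2 h3
      rw [map_add, h3, Pi.add_apply, inner_add_left, h1, h2, add_zero]
  zero_mem' := by
    have h := Lp.coeFn_zero (Eucl d) 2 (surfaceMeasure Ω)
    refine ⟨?_, ?_⟩
    · filter_upwards [ae_restrict_of_ae h] with x h3
      rw [map_zero, h3, Pi.zero_apply]
    · filter_upwards [ae_restrict_of_ae h] with x h3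
      rw [map_zero, h3, Pi.zero_apply, inner_zero_left]
  smul_mem' := by
    rintro c v ⟨hv, hv'⟩
    have h := Lp.coeFn_smul c (trace Ω v)
    refine ⟨?_, ?_⟩
    · filter_upwards [hv, ae_restrict_of_ae h] with x h1 h3
      rw [map_smul, h3, Pi.smul_apply, h1, smul_zero]
    · filter_upwards [hv', ae_restrict_of_ae h] with x h1 h3
      rw [map_smul, h3, Pi.smul_apply, real_inner_smul_left, h1, mul_zero]

instance (Ω ΓD ΓC : Set (Eucl d)) : NormedAddCommGroup (V Ω ΓD ΓC) :=
  (V Ω ΓD ΓC).normedAddCommGroup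

instance (Ω ΓD ΓC : Set (Eucl d)) : NormedSpace ℝ (V Ω ΓD ΓC) := (V Ω ΓD ΓC).normedSpace

/-- `X = L²(ΓC)`. -/
abbrev X (Ω ΓC : Set (Eucl d)) : Type := Lp ℝ 2 (segmentMeasure Ω ΓC)

/-- `X^d = L²(ΓC)^d`. -/
abbrev Xd (Ω ΓC : Set (Eucl d)) : Type := Lp (Eucl d) 2 (segmentMeasure Ω ΓC)

/-- The trace map `γ`, as an operator `V → X^d`. -/
def contactTrace (Ω ΓD ΓC : Set (Eucl d)) : V Ω ΓD ΓC →L[ℝ] Xd Ω ΓC :=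
  (LpToLpRestrictCLM (Eucl d) (Eucl d) ℝ (surfaceMeasure Ω) 2 ΓC).comp
    ((trace Ω).comp (V Ω ΓD ΓC).subtypeL)

/-- The Bochner space `L²(0,T,Y)`. -/
abbrev L2Time (T : ℝ) (Y : Type*) [NormedAddCommGroup Y] : Type _ :=
  Lp Y 2 (volume.restrict (Icc (0 : ℝ) T))

/-- The time-dependent trace `γ v ∈ L²(0,T,X^d)` of `v ∈ L²(0,T,V)`. -/
def traceTime {Ω ΓD ΓC : Set (Eucl d)} {T : ℝ} (v : L2Time T (V Ω ΓD ΓC)) :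
    L2Time T (Xd Ω ΓC) :=
  (contactTrace Ω ΓD ΓC).compLp v

/-- `α ∈ C(0,T,X)` is a (strong) solution of the state problem with rate `v ∈ L²(0,T,V)` and
initial state `α₀`: it is absolutely continuous on every compact subinterval of `(0,T)`, with
derivative `α'`, and `α'(t) + A(α(t)) = f(|γ v(t)|)` a.e. on `ΓC` for a.e. `t`. -/
def IsStateSolution {Ω ΓD ΓC : Set (Eucl d)} {T : ℝ} (A : ℝ → ℝ) (f : ℝ≥0 → ℝ)
    (α₀ : X Ω ΓC) (v : L2Time T (V Ω ΓD ΓC)) (α : C(Icc (0 : ℝ) T, X Ω ΓC)) : Prop :=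
  (∀ t : Icc (0 : ℝ) T, (t : ℝ) = 0 → α t = α₀) ∧
  ∃ α' : ℝ → X Ω ΓC,
    (∀ s t : Icc (0 : ℝ) T, 0 < (s : ℝ) → s ≤ t → (t : ℝ) < T →
      IntervalIntegrable α' volume s t ∧ α t - α s = ∫ r in (s : ℝ)..t, α' r) ∧
    ∀ᵐ t : ℝ, ∀ ht : t ∈ Icc (0 : ℝ) T, ∀ᵐ x ∂segmentMeasure Ω ΓC,
      α' t x + A (α ⟨t, ht⟩ x) = f ‖traceTime v t x‖₊

/-- `a` is a pointwise representative of `α ∈ C(0,T,X)` with continuous paths: `α(t) = a(t, ·)`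
a.e. on `ΓC` for every `t ∈ [0,T]`, and `a(·, x)` is continuous on `[0,T]` for a.e. `x`. -/
def IsPathRep {Ω ΓC : Set (Eucl d)} {T : ℝ} (α : C(Icc (0 : ℝ) T, X Ω ΓC))
    (a : ℝ → Eucl d → ℝ) : Prop :=
  (∀ t : Icc (0 : ℝ) T, α t =ᵐ[segmentMeasure Ω ΓC] a t) ∧
  ∀ᵐ x ∂segmentMeasure Ω ΓC, ContinuousOn (fun t => a t x) (Icc 0 T)

/-- `p` is a pointwise representative of `w ∈ L²(0,T,X^d)`: it is jointly measurable, and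
`w(t) = p(t, ·)` a.e. on `ΓC` for a.e. `t ∈ (0,T)`. -/
def IsJointRep {Ω ΓC : Set (Eucl d)} {T : ℝ} (w : L2Time T (Xd Ω ΓC))
    (p : ℝ → Eucl d → Eucl d) : Prop :=
  Measurable (fun z : ℝ × Eucl d => p z.1 z.2) ∧
  ∀ᵐ t ∂volume.restrict (Icc (0 : ℝ) T), w t =ᵐ[segmentMeasure Ω ΓC] p t

end RateState

end

namespace RateState

open Filter Topology

/-! ### Finiteness of the surface measure -/

section SurfaceMeasure

variable {d : ℕ}

/-! For fixed `x` the state equation is a scalar equation `a' + A(a) = F` with `F = f(|p(·, x)|)`,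
where `p` is a jointly measurable representative of the trace of the rate. Two solutions with
forcings `F` and `G` satisfy `|a - b|' ≤ |F - G|`, because the monotone term can only bring them
together. As the initial values agree and `f` is Lipschitz, this is the pointwise estimate. The norm
estimate follows by Cauchy–Schwarz in time and Tonelli on the product of `[0, T]` and `ΓC`;
boundedness of the trace map turns it into the Lipschitz bound.

The work lies in passing from an equation in `L²(ΓC)` to scalar equations on all of `[0, T]`. The
derivative `α'` has a jointly measurable representative `g` (`exists_joint_measurable`), and Bochner
integrals of it are computed pointwise (`coeFn_integral_ae_eq`), so that integrating `g(·, x)` from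
an interior time gives candidate paths. However, `α'` is only locally integrable on `(0, T)`.
Integrability of `g(·, x)` up to the end points comes from the equation itself: comparison with the
zero function bounds the path, so `A` along the path is bounded and `g = F - A(a)` is integrable
(`integrableOn_rate_of_monotone_equation`).

The geometry of `Ω` enters only through the finiteness of the surface measure on `ΓC`, which gives
`L² ⊆ L¹` and makes constants integrable. -/

theorem inner_eq_of_mem_frontier {Ω U : Set (Eucl d)} {e y : Eucl d} {h : (ℝ ∙ e)ᗮ → ℝ}
    (hΩ : IsOpen Ω) (hU : IsOpen U) (hh : Continuous h)
    (hUΩ : ∀ y ∈ U, (y ∈ Ω ↔ ⟪y, e⟫_ℝ < h ((ℝ ∙ e)ᗮ.orthogonalProjectionOnto y)))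
    (hyU : y ∈ U) (hy : y ∈ frontier Ω) :
    ⟪y, e⟫_ℝ = h ((ℝ ∙ e)ᗮ.orthogonalProjectionOnto y) := by
  rw [hΩ.frontier_eq] at hy
  apply le_antisymm
  · by_contra! hlt
    have hopen : IsOpen {z : Eucl d | h ((ℝ ∙ e)ᗮ.orthogonalProjectionOnto z) < ⟪z, e⟫_ℝ} :=
      isOpen_lt (by fun_prop) (by fun_prop)
    obtain ⟨z, ⟨hzU, hz⟩, hzΩ⟩ := mem_closure_iff.1 hy.1 _ (hU.inter hopen) ⟨hyU, hlt⟩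
    exact lt_asymm hz ((hUΩ z hzU).1 hzΩ)
  · by_contra! hlt
    exact hy.2 ((hUΩ y hyU).2 hlt)

theorem finrank_orthogonal_span_unit {e : Eucl d} (he : ‖e‖ = 1) :
    Module.finrank ℝ (ℝ ∙ e)ᗮ = d - 1 := by
  have h1 := (ℝ ∙ e).finrank_add_finrank_orthogonal
  have h2 : Module.finrank ℝ (ℝ ∙ e) = 1 :=
    finrank_span_singleton (by rintro rfl; simp at he)
  simp only [h2, finrank_euclideanSpace, Fintype.card_fin] at h1
  omega

/-- The graph map is `(1 + K)`-Lipschitz, so it enlarges `(d - 1)`-dimensional Hausdorff measure by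
at most the factor `(1 + K) ^ (d - 1)`. -/
theorem euclideanHausdorffMeasure_graph_ball_lt_top {e : Eucl d} (he : ‖e‖ = 1) {K : ℝ≥0}
    {h : (ℝ ∙ e)ᗮ → ℝ} (hh : LipschitzWith K h) (R : ℝ) :
    Measure.euclideanHausdorffMeasure (d - 1)
      ((fun z : (ℝ ∙ e)ᗮ => (z : Eucl d) + h z • e) '' Metric.ball 0 R) < ⊤ := by
  have hg : LipschitzWith (1 + K) (fun z : (ℝ ∙ e)ᗮ => (z : Eucl d) + h z • e) := by
    refine LipschitzWith.add (LipschitzWith.subtype_val _) ?_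
    refine LipschitzWith.of_dist_le_mul fun x y => ?_
    rw [dist_eq_norm, ← sub_smul, norm_smul, he, mul_one, ← dist_eq_norm]
    exact hh.dist_le_mul x y
  have h1 := hg.hausdorffMeasure_image_le (d := ((d - 1 : ℕ) : ℝ)) (by positivity)
    (Metric.ball 0 R)
  -- The hyperplane has dimension `d - 1`, and Hausdorff measure of the full dimension is finite on
  -- balls.
  have h2 : μH[((d - 1 : ℕ) : ℝ)] (Metric.ball (0 : (ℝ ∙ e)ᗮ) R) < ⊤ := by
    rw [← finrank_orthogonal_span_unit he]
    exact measure_ball_lt_top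
  rw [Measure.euclideanHausdorffMeasure_def, Measure.smul_apply]
  refine ENNReal.mul_lt_top ENNReal.coe_lt_top (h1.trans_lt (ENNReal.mul_lt_top ?_ h2))
  exact ENNReal.rpow_lt_top_of_nonneg (by positivity) (by simp)

/-- By compactness it is enough to bound the measure near each boundary point, where the boundary
lies in a Lipschitz graph. The graph over a ball suffices, since orthogonal projection does not
increase the norm. -/
theorem euclideanHausdorffMeasure_frontier_lt_top {Ω : Set (Eucl d)} (hΩo : IsOpen Ω)
    (hΩb : Bornology.IsBounded Ω) (hΩL : HasLipschitzBoundary Ω) :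
    Measure.euclideanHausdorffMeasure (d - 1) (frontier Ω) < ⊤ := by
  have hc : IsCompact (frontier Ω) :=
    Metric.isCompact_of_isClosed_isBounded isClosed_frontier
      (hΩb.closure.subset frontier_subset_closure)
  obtain ⟨R, hR⟩ := hc.isBounded.subset_ball 0
  refine hc.measure_lt_top_of_nhdsWithin fun x hx => ?_
  obtain ⟨U, e, K, h, hU, hxU, he, hh, hUΩ⟩ := hΩL x hx
  refine ⟨U ∩ frontier Ω, inter_mem (mem_nhdsWithin_of_mem_nhds (hU.mem_nhds hxU))
    self_mem_nhdsWithin, ?_⟩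
  refine (measure_mono ?_).trans_lt (euclideanHausdorffMeasure_graph_ball_lt_top he hh R)
  rintro y ⟨hyU, hy⟩
  refine ⟨(ℝ ∙ e)ᗮ.orthogonalProjectionOnto y, ?_, ?_⟩
  · rw [mem_ball_zero_iff]
    refine (Submodule.norm_orthogonalProjectionOnto_apply_le _ y).trans_lt ?_
    simpa using hR hy
  · have h1 := inner_eq_of_mem_frontier hΩo hU hh.continuous hUΩ hyU hy
    have h2 := (ℝ ∙ e).starProjection_add_starProjection_orthogonal y
    have h3 := Submodule.starProjection_unit_singleton ℝ he y
    simp only [← h1]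
    rw [real_inner_comm, ← h3, add_comm]
    exact h2

theorem isFiniteMeasure_segmentMeasure {Ω : Set (Eucl d)} (hΩo : IsOpen Ω)
    (hΩb : Bornology.IsBounded Ω) (hΩL : HasLipschitzBoundary Ω) (ΓC : Set (Eucl d)) :
    IsFiniteMeasure (segmentMeasure Ω ΓC) := by
  have : IsFiniteMeasure (surfaceMeasure Ω) :=
    ⟨by simpa [surfaceMeasure] using euclideanHausdorffMeasure_frontier_lt_top hΩo hΩb hΩL⟩
  unfold segmentMeasure
  infer_instance

end SurfaceMeasure

/-! ### Jointly measurable representatives of `Lp`-valued maps -/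

section JointRepresentatives

variable {α β E : Type*} [MeasurableSpace α] [MeasurableSpace β] [NormedAddCommGroup E]
  {ν : Measure α} {μ : Measure β} {p : ℝ≥0∞}

/-- A summable rate of convergence forces pointwise convergence almost everywhere without passing to
a subsequence; a subsequence is used only to identify the limit. -/
theorem Lp.ae_tendsto_of_norm_sub_lt [CompleteSpace E] [Fact (1 ≤ p)] {f : ℕ → Lp E p μ}
    {w : Lp E p μ} (h : ∀ n, ‖f n - w‖ < (1 / 2) ^ n) :
    ∀ᵐ x ∂μ, Tendsto (fun n => f n x) atTop (𝓝 (w x)) := by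
  have hnorm (u v : Lp E p μ) : eLpNorm (u - v : β → E) p μ = ENNReal.ofReal ‖u - v‖ := by
    rw [← eLpNorm_congr_ae (Lp.coeFn_sub u v), ofReal_norm, Lp.enorm_def]
  have hB : Summable fun n : ℕ => 2 * (1 / 2 : ℝ) ^ n :=
    (summable_geometric_of_lt_one (by norm_num) (by norm_num)).mul_left 2
  have hcau := Lp.ae_tendsto_of_cauchy_eLpNorm (μ := μ) (f := fun n => (f n : β → E))
    (fun n => Lp.aestronglyMeasurable _) (Fact.out : 1 ≤ p)
    (B := fun n => ENNReal.ofReal (2 * (1 / 2) ^ n)) hB.tsum_ofReal_ne_top (by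
      intro N n m hn hm
      rw [hnorm, ENNReal.ofReal_lt_ofReal_iff (by positivity)]
      have h1 : ‖f n - f m‖ ≤ ‖f n - w‖ + ‖f m - w‖ := by
        rw [norm_sub_rev (f m) w]; exact norm_sub_le_norm_sub_add_norm_sub ..
      have h2 : (1 / 2 : ℝ) ^ n ≤ (1 / 2) ^ N :=
        pow_le_pow_of_le_one (by norm_num) (by norm_num) hn
      have h3 : (1 / 2 : ℝ) ^ m ≤ (1 / 2) ^ N :=
        pow_le_pow_of_le_one (by norm_num) (by norm_num) hm
      linarith [h n, h m])
  have hlim : Tendsto f atTop (𝓝 w) := by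
    rw [tendsto_iff_norm_sub_tendsto_zero]
    exact squeeze_zero (fun _ => norm_nonneg _) (fun n => (h n).le)
      (tendsto_pow_atTop_nhds_zero_of_lt_one (by norm_num) (by norm_num))
  obtain ⟨φ, hφ, hφlim⟩ := (tendstoInMeasure_of_tendsto_Lp hlim).exists_seq_tendsto_ae
  filter_upwards [hcau, hφlim] with x ⟨l, hl⟩ hx
  rwa [tendsto_nhds_unique hx (hl.comp hφ.tendsto_atTop)]

/-- A strongly measurable map into `Lp` has a jointly measurable representative. -/
theorem exists_joint_measurable [CompleteSpace E] [SecondCountableTopology E] [MeasurableSpace E]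
    [BorelSpace E] [Fact (1 ≤ p)] {w : α → Lp E p μ} (hw : AEStronglyMeasurable w ν) :
    ∃ P : α → β → E, Measurable (fun z : α × β => P z.1 z.2) ∧ ∀ᵐ t ∂ν, w t =ᵐ[μ] P t := by
  classical
  obtain ⟨w', hw', hww'⟩ := hw
  obtain ⟨c, hc, hwc⟩ := hw'.isSeparable_range
  -- Inserting `0` makes the countable set nonempty, so that it can be enumerated.
  obtain ⟨e, he⟩ := (hc.insert 0).exists_eq_range (insert_nonempty _ _)
  have hex (n : ℕ) (t : α) : ∃ k, ‖e k - w' t‖ < (1 / 2) ^ n := by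
    have h1 : w' t ∈ closure (range e) :=
      he ▸ closure_mono (subset_insert _ _) (hwc (mem_range_self t))
    obtain ⟨_, ⟨k, rfl⟩, hk⟩ := Metric.mem_closure_iff.1 h1 ((1 / 2) ^ n) (by positivity)
    exact ⟨k, by rwa [← dist_eq_norm, dist_comm]⟩
  -- Taking the first index within `2⁻ⁿ` of `w' t` approximates `w'` by countably valued maps, for
  -- which joint measurability is immediate; their pointwise limit is the representative.
  have hN (n : ℕ) : Measurable fun t => Nat.find (hex n t) :=
    measurable_find (hex n) fun k =>
      (stronglyMeasurable_const.sub hw').norm.measurableSet_lt stronglyMeasurable_const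
  have hecoe : Measurable fun z : ℕ × β => e z.1 z.2 :=
    measurable_from_prod_countable_right fun k => (Lp.stronglyMeasurable (e k)).measurable
  have hq (n : ℕ) : Measurable fun z : α × β => e (Nat.find (hex n z.1)) z.2 :=
    hecoe.comp (((hN n).comp measurable_fst).prodMk measurable_snd)
  refine ⟨fun t x => limUnder atTop fun n => e (Nat.find (hex n t)) x,
    (StronglyMeasurable.limUnder fun n => (hq n).stronglyMeasurable).measurable, ?_⟩
  filter_upwards [hww'] with t ht
  rw [ht]
  filter_upwards [Lp.ae_tendsto_of_norm_sub_lt fun n => Nat.find_spec (hex n t)] with x hx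
  exact hx.limUnder_eq.symm

theorem eLpNorm_two_eq_lintegral {γ : Type*} [MeasurableSpace γ] {ρ : Measure γ} (g : γ → E) :
    eLpNorm g 2 ρ ^ 2 = ∫⁻ x, ‖g x‖ₑ ^ 2 ∂ρ := by
  have := eLpNorm_nnreal_pow_eq_lintegral (μ := ρ) (f := g) (p := 2) (by norm_num)
  simpa using this

theorem lintegral_joint_sq {w : Lp (Lp E 2 μ) 2 ν} {P : α → β → E}
    (hwP : ∀ᵐ t ∂ν, w t =ᵐ[μ] P t) :
    ∫⁻ t, ∫⁻ x, ‖P t x‖ₑ ^ 2 ∂μ ∂ν = ‖w‖ₑ ^ 2 := by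
  rw [Lp.enorm_def, eLpNorm_two_eq_lintegral]
  refine lintegral_congr_ae ?_
  filter_upwards [hwP] with t ht
  rw [Lp.enorm_def, eLpNorm_two_eq_lintegral]
  refine lintegral_congr_ae ?_
  filter_upwards [ht] with x hx
  rw [hx]

variable [MeasurableSpace E] [BorelSpace E] [SecondCountableTopology E]

theorem memLp_two_joint [SFinite μ] {w : Lp (Lp E 2 μ) 2 ν}
    {P : α → β → E} (hP : Measurable fun z : α × β => P z.1 z.2)
    (hwP : ∀ᵐ t ∂ν, w t =ᵐ[μ] P t) :
    MemLp (fun z : α × β => P z.1 z.2) 2 (ν.prod μ) := by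
  refine ⟨hP.aestronglyMeasurable, ?_⟩
  have h : eLpNorm (fun z : α × β => P z.1 z.2) 2 (ν.prod μ) ^ 2 = ‖w‖ₑ ^ 2 := by
    rw [eLpNorm_two_eq_lintegral, lintegral_prod _ (by fun_prop), lintegral_joint_sq hwP]
  have h2 : ‖w‖ₑ ^ 2 < ⊤ := by simp
  rw [← h] at h2
  simpa using h2

/-- Hölder's inequality in the second variable: on a finite measure space the `L¹` norm is at most a
constant times the `L²` norm. -/
theorem integrable_joint [IsFiniteMeasure μ] {h : α → Lp E 2 μ}
    (hh : Integrable h ν) {P : α → β → E} (hP : Measurable fun z : α × β => P z.1 z.2)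
    (hhP : ∀ᵐ t ∂ν, h t =ᵐ[μ] P t) :
    Integrable (fun z : α × β => P z.1 z.2) (ν.prod μ) := by
  refine ⟨hP.aestronglyMeasurable, ?_⟩
  rw [hasFiniteIntegral_iff_enorm, lintegral_prod _ (by fun_prop)]
  have hC : μ univ ^ (1 / 2 : ℝ) < ⊤ :=
    ENNReal.rpow_lt_top_of_nonneg (by positivity) (measure_ne_top _ _)
  calc ∫⁻ t, ∫⁻ x, ‖P t x‖ₑ ∂μ ∂ν ≤ ∫⁻ t, ‖h t‖ₑ * μ univ ^ (1 / 2 : ℝ) ∂ν := by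
        refine lintegral_mono_ae ?_
        filter_upwards [hhP] with t ht
        have h1 : ∫⁻ x, ‖P t x‖ₑ ∂μ = eLpNorm (h t) 1 μ := by
          rw [eLpNorm_one_eq_lintegral_enorm]
          exact lintegral_congr_ae (ht.mono fun x hx => by simp only [hx])
        have h2 := eLpNorm_le_eLpNorm_mul_rpow_measure_univ (μ := μ) (p := 1) (q := 2)
          (by norm_num) (Lp.aestronglyMeasurable (h t))
        rw [h1, Lp.enorm_def]
        convert h2 using 3
        norm_num
    _ = (∫⁻ t, ‖h t‖ₑ ∂ν) * μ univ ^ (1 / 2 : ℝ) :=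
        lintegral_mul_const' _ _ hC.ne
    _ < ⊤ := ENNReal.mul_lt_top hh.2 hC

/-- Bochner integrals in `L²` can be computed pointwise. -/
theorem coeFn_integral_ae_eq [SFinite ν] [IsFiniteMeasure μ] {h : α → Lp ℝ 2 μ}
    (hh : Integrable h ν) {P : α → β → ℝ} (hP : Measurable fun z : α × β => P z.1 z.2)
    (hhP : ∀ᵐ t ∂ν, h t =ᵐ[μ] P t) :
    (∫ t, h t ∂ν : Lp ℝ 2 μ) =ᵐ[μ] fun x => ∫ t, P t x ∂ν := by
  have hint := integrable_joint hh hP hhP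
  -- Both sides are compared on measurable sets `s`: the inner product with the indicator of `s`
  -- commutes with the Bochner integral, and Fubini swaps the remaining integrals.
  refine Integrable.ae_eq_of_forall_setIntegral_eq _ _
    ((Lp.memLp _).integrable (by norm_num)) hint.integral_prod_right fun s hs _ => ?_
  have hinner (u : Lp ℝ 2 μ) :
      ⟪indicatorConstLp 2 hs (measure_ne_top μ s) (1 : ℝ), u⟫_ℝ = ∫ x in s, u x ∂μ :=
    L2.inner_indicatorConstLp_one hs _ u
  have hrestr : Integrable (fun z : α × β => P z.1 z.2) (ν.prod (μ.restrict s)) := by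
    rw [← Measure.restrict_univ (μ := ν), Measure.prod_restrict]
    exact hint.restrict
  rw [← hinner, ← integral_inner hh, integral_integral_swap]
  · refine integral_congr_ae ?_
    filter_upwards [hhP] with t ht
    rw [hinner]
    exact integral_congr_ae (ae_restrict_of_ae ht)
  · exact hrestr.swap

end JointRepresentatives

/-! ### The scalar equation with a monotone term -/

section ScalarEquation

variable {A a b F G : ℝ → ℝ} {s t : ℝ}

/-- After the last time at which `a ≤ b`, monotonicity gives `A(a) ≥ A(b)`, so `a - b` grows no
faster than the integral of `|F - G|`. Using the last such time avoids differentiating `|a - b|`. -/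
theorem sub_le_of_monotone_equation (hA : Monotone A) (hAc : Continuous A) (hst : s ≤ t)
    (ha : ContinuousOn a (Icc s t)) (hb : ContinuousOn b (Icc s t))
    (hF : IntervalIntegrable F volume s t) (hG : IntervalIntegrable G volume s t)
    (hea : ∀ r ∈ Icc s t, a t - a r = ∫ τ in r..t, (F τ - A (a τ)))
    (heb : ∀ r ∈ Icc s t, b t - b r = ∫ τ in r..t, (G τ - A (b τ))) :
    a t - b t ≤ |a s - b s| + ∫ τ in s..t, |F τ - G τ| := by
  have hFG : IntervalIntegrable (fun τ => |F τ - G τ|) volume s t := (hF.sub hG).abs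
  have hAa : IntervalIntegrable (fun τ => A (a τ)) volume s t :=
    (hAc.comp_continuousOn ha).intervalIntegrable_of_Icc hst
  have hAb : IntervalIntegrable (fun τ => A (b τ)) volume s t :=
    (hAc.comp_continuousOn hb).intervalIntegrable_of_Icc hst
  rcases le_or_gt (a t) (b t) with hab | hab
  · have := intervalIntegral.integral_nonneg (μ := volume) (f := fun τ => |F τ - G τ|) hst
      fun _ _ => abs_nonneg _
    linarith [abs_nonneg (a s - b s)]
  -- `σ` is the last time with `a ≤ b`, or the initial time `s` if there is none.
  obtain ⟨σ, hσ, hσ0, hσt⟩ : ∃ σ ∈ Icc s t, a σ - b σ ≤ |a s - b s| ∧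
      ∀ r ∈ Ioc σ t, b r ≤ a r := by
    rcases (Icc s t ∩ {r | a r ≤ b r}).eq_empty_or_nonempty with hZ | hZ
    · refine ⟨s, left_mem_Icc.2 hst, le_abs_self _, fun r hr => ?_⟩
      by_contra! h
      exact (hZ ▸ (⟨Ioc_subset_Icc_self hr, h.le⟩ : r ∈ Icc s t ∩ {r | a r ≤ b r}) : r ∈ (∅ : Set ℝ))
    · have hclosed : IsClosed (Icc s t ∩ {r | a r ≤ b r}) :=
        isClosed_Icc.isClosed_le ha hb
      obtain ⟨σ, ⟨hσ, hσ0⟩, hmax⟩ :=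
        (isCompact_Icc.of_isClosed_subset hclosed inter_subset_left).exists_isGreatest hZ
      refine ⟨σ, hσ, (sub_nonpos.2 hσ0).trans (abs_nonneg _), fun r hr => ?_⟩
      by_contra! h
      exact hr.1.not_ge (hmax ⟨⟨hσ.1.trans hr.1.le, hr.2⟩, h.le⟩)
  have hsub : uIcc σ t ⊆ uIcc s t := by
    rw [uIcc_of_le hst, uIcc_of_le hσ.2]; exact Icc_subset_Icc_left hσ.1
  have h1 : (a t - b t) - (a σ - b σ) ≤ ∫ τ in σ..t, |F τ - G τ| := by
    have h2 : (a t - b t) - (a σ - b σ)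
        = ∫ τ in σ..t, ((F τ - A (a τ)) - (G τ - A (b τ))) := by
      rw [intervalIntegral.integral_sub ((hF.sub hAa).mono_set hsub) ((hG.sub hAb).mono_set hsub),
        ← hea σ hσ, ← heb σ hσ]
      ring
    rw [h2]
    refine intervalIntegral.integral_mono_on_of_le_Ioo hσ.2
      (((hF.sub hAa).sub (hG.sub hAb)).mono_set hsub) (hFG.mono_set hsub) fun r hr => ?_
    linarith [hA (hσt r (Ioo_subset_Ioc_self hr)), le_abs_self (F r - G r)]
  have h3 : ∫ τ in σ..t, |F τ - G τ| ≤ ∫ τ in s..t, |F τ - G τ| :=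
    intervalIntegral.integral_mono_interval hσ.1 hσ.2 le_rfl
      (Eventually.of_forall fun _ => abs_nonneg _) hFG
  linarith

/-- Comparison of solutions of `a' + A(a) = F` and `b' + A(b) = G` for monotone `A`. -/
theorem abs_sub_le_of_monotone_equation (hA : Monotone A) (hAc : Continuous A) (hst : s ≤ t)
    (ha : ContinuousOn a (Icc s t)) (hb : ContinuousOn b (Icc s t))
    (hF : IntervalIntegrable F volume s t) (hG : IntervalIntegrable G volume s t)
    (hea : ∀ r ∈ Icc s t, a t - a r = ∫ τ in r..t, (F τ - A (a τ)))
    (heb : ∀ r ∈ Icc s t, b t - b r = ∫ τ in r..t, (G τ - A (b τ))) :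
    |a t - b t| ≤ |a s - b s| + ∫ τ in s..t, |F τ - G τ| := by
  rw [abs_sub_le_iff]
  refine ⟨sub_le_of_monotone_equation hA hAc hst ha hb hF hG hea heb, ?_⟩
  rw [abs_sub_comm]
  simp_rw [abs_sub_comm (F _)]
  exact sub_le_of_monotone_equation hA hAc hst hb ha hG hF heb hea

theorem continuousOn_primitive_Ioo {g : ℝ → ℝ} {T c a₀ : ℝ} (hc : c ∈ Ioo 0 T)
    (hg : ∀ s t, 0 < s → s ≤ t → t < T → IntervalIntegrable g volume s t)
    (ha : ∀ t, a t = a₀ + ∫ r in c..t, g r) (hs : 0 < s) (ht : t < T) :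
    ContinuousOn a (Icc s t) := by
  have h1 : a = fun t => a₀ + ∫ r in c..t, g r := funext ha
  rw [h1]
  have h2 := hg (min s c) (max t c) (lt_min hs hc.1) ((min_le_right _ _).trans (le_max_right _ _))
    (max_lt ht hc.2)
  refine (continuousOn_const.add (intervalIntegral.continuousOn_primitive_interval' h2 ?_)).mono ?_
  · rw [uIcc_of_le ((min_le_right _ _).trans (le_max_right _ _))]
    exact ⟨min_le_right _ _, le_max_right _ _⟩
  · rw [uIcc_of_le ((min_le_right _ _).trans (le_max_right _ _))]
    exact Icc_subset_Icc (min_le_left _ _) (le_max_left _ _)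

/-- The path is bounded along a sequence of times tending to `0`. Comparison started at these times
bounds it on all of `(0, T)`, so `A(a)` is bounded and `g = F - A(a)` inherits integrability from
`F`. -/
theorem integrableOn_rate_of_monotone_equation {g : ℝ → ℝ} {T c a₀ l : ℝ} {u : ℕ → ℝ}
    (hA : Monotone A) (hAc : Continuous A) (hc : c ∈ Ioo 0 T)
    (hg : ∀ s t, 0 < s → s ≤ t → t < T → IntervalIntegrable g volume s t)
    (ha : ∀ t, a t = a₀ + ∫ r in c..t, g r) (hF : IntegrableOn F (Icc 0 T))
    (heq : ∀ᵐ r ∂volume.restrict (Icc 0 T), g r + A (a r) = F r)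
    (hu : ∀ n, u n ∈ Ioo 0 T) (hu0 : Tendsto u atTop (𝓝 0))
    (hl : Tendsto (fun n => a (u n)) atTop (𝓝 l)) :
    IntegrableOn g (Icc 0 T) := by
  have hcont : ∀ s t, 0 < s → t < T → ContinuousOn a (Icc s t) := fun s t hs ht =>
    continuousOn_primitive_Ioo hc hg ha hs ht
  have hcontIoo : ContinuousOn a (Ioo 0 T) := fun r hr =>
    ((hcont (r / 2) ((r + T) / 2) (by linarith [hr.1]) (by linarith [hr.2])).continuousAt
      (Icc_mem_nhds (by linarith [hr.1]) (by linarith [hr.2]))).continuousWithinAt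
  have hT : 0 ≤ T := (hc.1.trans hc.2).le
  have hFi : ∀ s t, 0 ≤ s → s ≤ t → t ≤ T → IntervalIntegrable F volume s t :=
    fun s t hs hst ht => (intervalIntegrable_iff_integrableOn_Icc_of_le hst).2
      (hF.mono_set (Icc_subset_Icc hs ht))
  have hdiff : ∀ r t, 0 < r → r ≤ t → t < T → a t - a r = ∫ τ in r..t, (F τ - A (a τ)) := by
    intro r t hr hrt ht
    have hgi : ∀ v, 0 < v → v < T → IntervalIntegrable g volume c v := fun v hv hvT =>
      (le_total c v).elim (fun h => hg c v hc.1 h hvT) (fun h => (hg v c hv h hc.2).symm)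
    have h1 : a t - a r = ∫ τ in r..t, g τ := by
      rw [ha, ha, add_sub_add_left_eq_sub, intervalIntegral.integral_interval_sub_left
        (hgi t (hr.trans_le hrt) ht) (hgi r hr (hrt.trans_lt ht))]
    rw [h1]
    refine intervalIntegral.integral_congr_ae ?_
    rw [ae_restrict_iff' measurableSet_Icc] at heq
    filter_upwards [heq] with τ hτ hmem
    rw [uIoc_of_le hrt] at hmem
    linarith [hτ ⟨hr.le.trans hmem.1.le, hmem.2.trans ht.le⟩]
  obtain ⟨C, hC⟩ := (hl.abs.isBoundedUnder_le).bddAbove_range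
  have hbound : ∀ t ∈ Ioo 0 T, |a t| ≤ C + ∫ τ in 0..T, |F τ - A 0| := by
    intro t ht
    obtain ⟨n, hn⟩ := (hu0.eventually (gt_mem_nhds ht.1)).exists
    have hci (s t : ℝ) : IntervalIntegrable (fun _ => A 0) volume s t :=
      intervalIntegrable_const
    -- The zero function solves the equation with constant forcing `A 0`.
    have h1 := abs_sub_le_of_monotone_equation (b := fun _ => 0) (G := fun _ => A 0) hA hAc hn.le
      (hcont (u n) t (hu n).1 ht.2) continuousOn_const (hFi (u n) t (hu n).1.le hn.le ht.2.le)
      (hci _ _) (fun r hr => hdiff r t ((hu n).1.trans_le hr.1) hr.2 ht.2)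
      (fun r hr => by simp)
    have h2 : ∫ τ in (u n)..t, |F τ - A 0| ≤ ∫ τ in 0..T, |F τ - A 0| :=
      intervalIntegral.integral_mono_interval (hu n).1.le hn.le ht.2.le
        (Eventually.of_forall fun _ => abs_nonneg _)
        ((hFi 0 T le_rfl hT le_rfl).sub (hci _ _)).abs
    simp only [sub_zero] at h1
    have h3 : |a (u n)| ≤ C := hC ⟨n, rfl⟩
    linarith
  set M := C + ∫ τ in 0..T, |F τ - A 0|
  have hAa : IntegrableOn (fun r => A (a r)) (Ioo 0 T) := by
    refine Integrable.of_bound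
      ((hAc.comp_continuousOn hcontIoo).aestronglyMeasurable measurableSet_Ioo)
      (max |A M| |A (-M)|) ?_
    refine (ae_restrict_iff' measurableSet_Ioo).2 (Eventually.of_forall fun r hr => ?_)
    have h := abs_le.1 (hbound r hr)
    rw [Real.norm_eq_abs, max_comm]
    exact abs_le_max_abs_abs (hA h.1) (hA h.2)
  rw [← integrableOn_Icc_iff_integrableOn_Ioo] at hAa
  refine (hF.sub hAa).congr ?_
  filter_upwards [heq] with r hr
  simp only [Pi.sub_apply]
  linarith

end ScalarEquation

/-! ### Continuous paths of strong solutions -/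

section PathRepresentatives

variable {β : Type*} [MeasurableSpace β] {μ : Measure β} {T : ℝ}

/-- Continuity into `L²` lets the interior times be chosen with error below `2⁻ⁿ`. This gives access
to the end points, where the derivative gives no direct control. -/
theorem exists_seq_ae_tendsto_path (hT : 0 < T) (α : C(Icc (0 : ℝ) T, Lp ℝ 2 μ))
    (t : Icc (0 : ℝ) T) :
    ∃ u : ℕ → Icc (0 : ℝ) T, (∀ n, (u n : ℝ) ∈ Ioo 0 T) ∧
      Tendsto (fun n => (u n : ℝ)) atTop (𝓝 t) ∧
      ∀ᵐ x ∂μ, Tendsto (fun n => α (u n) x) atTop (𝓝 (α t x)) := by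
  have hclos : (t : ℝ) ∈ closure (Ioo 0 T) := by rw [closure_Ioo hT.ne]; exact t.2
  have hex (n : ℕ) : ∃ s : Icc (0 : ℝ) T, (s : ℝ) ∈ Ioo 0 T ∧
      dist (s : ℝ) t < (1 / 2) ^ n ∧ ‖α s - α t‖ < (1 / 2) ^ n := by
    obtain ⟨δ, hδ, h⟩ := Metric.continuous_iff.1 α.continuous t ((1 / 2) ^ n) (by positivity)
    obtain ⟨s, hs, hst⟩ := Metric.mem_closure_iff.1 hclos (min δ ((1 / 2) ^ n)) (by positivity)
    rw [dist_comm] at hst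
    refine ⟨⟨s, Ioo_subset_Icc_self hs⟩, hs, hst.trans_le (min_le_right _ _), ?_⟩
    rw [← dist_eq_norm]
    exact h _ (hst.trans_le (min_le_left _ _))
  choose u hu1 hu2 hu3 using hex
  refine ⟨u, hu1, ?_, Lp.ae_tendsto_of_norm_sub_lt hu3⟩
  rw [tendsto_iff_dist_tendsto_zero]
  exact squeeze_zero (fun _ => dist_nonneg) (fun n => (hu2 n).le)
    (tendsto_pow_atTop_nhds_zero_of_lt_one (by norm_num) (by norm_num))

/-- The variable domain of integration becomes an indicator on the product space, leaving a
parametric integral over a fixed space. -/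
theorem measurable_joint_primitive {g : ℝ → β → ℝ}
    (hg : Measurable fun z : ℝ × β => g z.1 z.2) (c : ℝ) :
    Measurable fun z : ℝ × β => ∫ r in c..z.1, g r z.2 := by
  have key (S : ℝ → Set ℝ) (hS : MeasurableSet {w : (ℝ × β) × ℝ | w.2 ∈ S w.1.1})
      (hS' : ∀ t, MeasurableSet (S t)) :
      Measurable fun z : ℝ × β => ∫ r in S z.1, g r z.2 := by
    have h1 : StronglyMeasurable fun w : (ℝ × β) × ℝ =>
        indicator {w : (ℝ × β) × ℝ | w.2 ∈ S w.1.1} (fun w => g w.2 w.1.2) w :=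
      ((hg.comp (by fun_prop : Measurable fun w : (ℝ × β) × ℝ => (w.2, w.1.2))).indicator
        hS).stronglyMeasurable
    convert (h1.integral_prod_right' (ν := volume)).measurable using 2 with z
    rw [← integral_indicator (hS' z.1)]
    rfl
  simp only [intervalIntegral]
  refine (key (fun t => Ioc c t) ?_ fun _ => measurableSet_Ioc).sub
    (key (fun t => Ioc t c) ?_ fun _ => measurableSet_Ioc)
  · exact (measurableSet_lt measurable_const measurable_snd).inter
      (measurableSet_le measurable_snd (measurable_fst.comp measurable_fst))
  · exact (measurableSet_lt (measurable_fst.comp measurable_fst) measurable_snd).inter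
      (measurableSet_le measurable_snd measurable_const)

theorem locallyIntegrableOn_Ioo {E : Type*} [NormedAddCommGroup E] {g : ℝ → E}
    (hg : ∀ s t, 0 < s → s ≤ t → t < T → IntervalIntegrable g volume s t) :
    LocallyIntegrableOn g (Ioo 0 T) := by
  intro r hr
  refine ⟨Icc (r / 2) ((r + T) / 2), mem_nhdsWithin_of_mem_nhds
    (Icc_mem_nhds (by linarith [hr.1]) (by linarith [hr.2])), ?_⟩
  rw [← intervalIntegrable_iff_integrableOn_Icc_of_le (by linarith [hr.1, hr.2])]
  exact hg _ _ (by linarith [hr.1]) (by linarith [hr.1, hr.2]) (by linarith [hr.2])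

/-- The exceptional null set must not depend on `s` and `t`, so countably many intervals exhausting
`(0, T)` are used. The shift in `T / (n + 2)` keeps their end points in order. -/
theorem ae_forall_intervalIntegrable {g : ℝ → β → ℝ} (hT : 0 < T)
    (hg : ∀ s t, 0 < s → s ≤ t → t < T → ∀ᵐ x ∂μ, IntervalIntegrable (g · x) volume s t) :
    ∀ᵐ x ∂μ, ∀ s t, 0 < s → s ≤ t → t < T → IntervalIntegrable (g · x) volume s t := by
  have hpos (n : ℕ) : 0 < T / (n + 2) := by positivity
  have hhalf (n : ℕ) : T / (n + 2) ≤ T / 2 := by gcongr; linarith [n.cast_nonneg (α := ℝ)]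
  have h1 : ∀ᵐ x ∂μ, ∀ n : ℕ, IntervalIntegrable (g · x) volume (T / (n + 2)) (T - T / (n + 2)) :=
    ae_all_iff.2 fun n => hg _ _ (hpos n) (by linarith [hhalf n]) (by linarith [hpos n])
  filter_upwards [h1] with x hx s t hs hst ht
  have hlim : Tendsto (fun n : ℕ => T / ((n : ℝ) + 2)) atTop (𝓝 0) :=
    (tendsto_atTop_add_const_right _ _ tendsto_natCast_atTop_atTop).const_div_atTop T
  obtain ⟨n, hn1, hn2⟩ := ((hlim.eventually (gt_mem_nhds hs)).and
    (hlim.eventually (gt_mem_nhds (sub_pos.2 ht)))).exists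
  refine (hx n).mono_set ?_
  rw [uIcc_of_le hst, uIcc_of_le (by linarith [hhalf n])]
  exact Icc_subset_Icc hn1.le (by linarith)

/-- A strong solution of `α' + A(α) = F` in `L²` has a pointwise representative whose paths are
continuous up to the end points and solve the scalar equation in integrated form. -/
theorem exists_path_solution [IsFiniteMeasure μ] {A : ℝ → ℝ} (hA : Monotone A)
    (hAc : Continuous A) (hT : 0 < T) (α : C(Icc (0 : ℝ) T, Lp ℝ 2 μ)) {α' : ℝ → Lp ℝ 2 μ}
    (hα' : ∀ s t : Icc (0 : ℝ) T, 0 < (s : ℝ) → s ≤ t → (t : ℝ) < T →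
      IntervalIntegrable α' volume s t ∧ α t - α s = ∫ r in (s : ℝ)..t, α' r)
    {F : ℝ → β → ℝ} (hFm : Measurable fun z : ℝ × β => F z.1 z.2)
    (hF : Integrable (fun z : ℝ × β => F z.1 z.2) ((volume.restrict (Icc 0 T)).prod μ))
    (heq : ∀ᵐ t : ℝ, ∀ ht : t ∈ Icc (0 : ℝ) T, ∀ᵐ x ∂μ, α' t x + A (α ⟨t, ht⟩ x) = F t x) :
    ∃ a : ℝ → β → ℝ, (∀ t : Icc (0 : ℝ) T, α t =ᵐ[μ] a t) ∧
      ∀ᵐ x ∂μ, ContinuousOn (fun t => a t x) (Icc 0 T) ∧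
        IntegrableOn (fun r => F r x) (Icc 0 T) ∧
        ∀ s t, 0 ≤ s → s ≤ t → t ≤ T → a t x - a s x = ∫ r in s..t, (F r x - A (a r x)) := by
  have hα'i : ∀ s t, 0 < s → s ≤ t → t < T → IntervalIntegrable α' volume s t :=
    fun s t hs hst ht => (hα' ⟨s, hs.le, hst.trans ht.le⟩ ⟨t, hs.le.trans hst, ht.le⟩
      hs hst ht).1
  obtain ⟨g, hgm, hg⟩ := exists_joint_measurable (μ := μ)
    (locallyIntegrableOn_Ioo hα'i).aestronglyMeasurable
  have hgIoc {s t : ℝ} (hs : 0 < s) (ht : t < T) :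
      ∀ᵐ r ∂volume.restrict (Ioc s t), α' r =ᵐ[μ] g r :=
    ae_restrict_of_ae_restrict_of_subset (fun r (hr : r ∈ Ioc s t) => (⟨hs.trans hr.1, hr.2.trans_lt ht⟩ : r ∈ Ioo 0 T)) hg
  have hgi : ∀ᵐ x ∂μ, ∀ s t, 0 < s → s ≤ t → t < T → IntervalIntegrable (g · x) volume s t := by
    refine ae_forall_intervalIntegrable hT fun s t hs hst ht => ?_
    have h1 := (intervalIntegrable_iff_integrableOn_Ioc_of_le hst).1 (hα'i s t hs hst ht)
    filter_upwards [(integrable_joint h1 hgm (hgIoc hs ht)).prod_left_ae] with x hx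
    exact (intervalIntegrable_iff_integrableOn_Ioc_of_le hst).2 hx
  have hincr (s t : Icc (0 : ℝ) T) (hs : 0 < (s : ℝ)) (hst : s ≤ t) (ht : (t : ℝ) < T) :
      ∀ᵐ x ∂μ, α t x - α s x = ∫ r in (s : ℝ)..t, g r x := by
    obtain ⟨h1, h2⟩ := hα' s t hs hst ht
    rw [intervalIntegral.integral_of_le hst] at h2
    have h3 := coeFn_integral_ae_eq
      ((intervalIntegrable_iff_integrableOn_Ioc_of_le hst).1 h1) hgm (hgIoc hs ht)
    filter_upwards [h3, Lp.coeFn_sub (α t) (α s)] with x hx hx'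
    rw [intervalIntegral.integral_of_le hst, ← hx, ← h2, hx', Pi.sub_apply]
  have hcI : T / 2 ∈ Ioo 0 T := ⟨by positivity, by linarith⟩
  set c : Icc (0 : ℝ) T := ⟨T / 2, Ioo_subset_Icc_self hcI⟩
  -- The base point is interior because `g` is not yet known to be integrable up to `0` or `T`.
  set a : ℝ → β → ℝ := fun t x => α c x + ∫ r in (T / 2)..t, g r x with ha
  have ham : Measurable fun z : ℝ × β => a z.1 z.2 :=
    ((Lp.stronglyMeasurable (α c)).measurable.comp measurable_snd).add
      (measurable_joint_primitive hgm _)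
  have haα (t : Icc (0 : ℝ) T) (ht : (t : ℝ) ∈ Ioo 0 T) : α t =ᵐ[μ] a t := by
    rcases le_total c t with h | h
    · filter_upwards [hincr c t hcI.1 h ht.2] with x hx
      simp only [ha]
      rw [← hx]; ring
    · filter_upwards [hincr t c ht.1 h hcI.2] with x hx
      simp only [ha]
      rw [intervalIntegral.integral_symm, ← hx]; ring
  -- Joint measurability of `g`, `a` and `F` permits exchanging the two almost-everywhere
  -- quantifiers.
  have heq' : ∀ᵐ x ∂μ, ∀ᵐ t ∂volume.restrict (Icc 0 T), g t x + A (a t x) = F t x := by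
    refine (Measure.ae_ae_comm (p := fun t x => g t x + A (a t x) = F t x)
      (measurableSet_eq_fun (hgm.add (hAc.measurable.comp ham)) hFm)).1 ?_
    rw [← restrict_Ioo_eq_restrict_Icc]
    filter_upwards [hg, ae_restrict_of_ae heq, ae_restrict_mem measurableSet_Ioo]
      with t h1 h2 ht
    filter_upwards [h1, h2 (Ioo_subset_Icc_self ht), haα ⟨t, Ioo_subset_Icc_self ht⟩ ht]
      with x hx1 hx2 hx3
    rw [← hx1, ← hx3, hx2]
  obtain ⟨u, hu, hu0, hul⟩ := exists_seq_ae_tendsto_path hT α ⟨0, le_rfl, hT.le⟩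
  have hgI : ∀ᵐ x ∂μ, IntegrableOn (g · x) (Icc 0 T) := by
    filter_upwards [hgi, heq', hul, hF.prod_left_ae, ae_all_iff.2 fun n => haα (u n) (hu n)]
      with x h1 h2 h3 h4 h5
    simp only [h5] at h3
    exact integrableOn_rate_of_monotone_equation hA hAc hcI h1 (fun t => rfl) h4 h2 hu hu0 h3
  have hacont : ∀ᵐ x ∂μ, ContinuousOn (fun t => a t x) (Icc 0 T) := by
    filter_upwards [hgI] with x hx
    have h1 := (intervalIntegrable_iff_integrableOn_Icc_of_le hT.le).2 hx
    have h2 := intervalIntegral.continuousOn_primitive_interval' h1 (a := T / 2)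
      (by rw [uIcc_of_le hT.le]; exact Ioo_subset_Icc_self hcI)
    rw [uIcc_of_le hT.le] at h2
    exact continuousOn_const.add h2
  refine ⟨a, fun t => ?_, ?_⟩
  -- Interior times approximate `t`, which may be an end point; the limits of `α` in `L²` and of the
  -- continuous path must then agree.
  · obtain ⟨v, hv, hvt, hvl⟩ := exists_seq_ae_tendsto_path hT α t
    filter_upwards [hvl, hacont, ae_all_iff.2 fun n => haα (v n) (hv n)] with x h1 h2 h3
    simp only [h3] at h1
    refine tendsto_nhds_unique h1 ((h2 t t.2).tendsto.comp (tendsto_nhdsWithin_iff.2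
      ⟨hvt, Eventually.of_forall fun n => (v n).2⟩))
  · filter_upwards [hgI, hacont, hF.prod_left_ae, heq'] with x h1 h2 h3 h4
    refine ⟨h2, h3, fun s t hs hst ht => ?_⟩
    have hgv : ∀ v ∈ Icc 0 T, IntervalIntegrable (g · x) volume (T / 2) v := fun v hv =>
      ((intervalIntegrable_iff_integrableOn_Icc_of_le hT.le).2 h1).mono_set
        (by rw [uIcc_of_le hT.le]; exact uIcc_subset_Icc (Ioo_subset_Icc_self hcI) hv)
    simp only [ha]
    rw [add_sub_add_left_eq_sub, intervalIntegral.integral_interval_sub_left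
      (hgv t ⟨hs.trans hst, ht⟩) (hgv s ⟨hs, hst.trans ht⟩)]
    refine intervalIntegral.integral_congr_ae ?_
    rw [ae_restrict_iff' measurableSet_Icc] at h4
    filter_upwards [h4] with τ hτ hmem
    rw [uIoc_of_le hst] at hmem
    have := hτ ⟨hs.trans hmem.1.le, hmem.2.trans ht⟩
    simp only [ha] at this
    linarith

/-- Off one null set the paths agree at a countable dense set of times, hence everywhere by
continuity. This carries results for the constructed representative over to any other. -/
theorem ae_eqOn_of_path_representatives (hT : 0 < T) {α : C(Icc (0 : ℝ) T, Lp ℝ 2 μ)}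
    {a b : ℝ → β → ℝ} (ha : ∀ t : Icc (0 : ℝ) T, α t =ᵐ[μ] a t)
    (hb : ∀ t : Icc (0 : ℝ) T, α t =ᵐ[μ] b t)
    (hac : ∀ᵐ x ∂μ, ContinuousOn (fun t => a t x) (Icc 0 T))
    (hbc : ∀ᵐ x ∂μ, ContinuousOn (fun t => b t x) (Icc 0 T)) :
    ∀ᵐ x ∂μ, EqOn (fun t => a t x) (fun t => b t x) (Icc 0 T) := by
  have : Nonempty (Icc (0 : ℝ) T) := ⟨⟨0, le_rfl, hT.le⟩⟩
  filter_upwards [hac, hbc,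
    ae_all_iff.2 fun n => ha (TopologicalSpace.denseSeq (Icc (0 : ℝ) T) n),
    ae_all_iff.2 fun n => hb (TopologicalSpace.denseSeq (Icc (0 : ℝ) T) n)] with x h1 h2 h3 h4
  have h := Continuous.ext_on (TopologicalSpace.denseRange_denseSeq (Icc (0 : ℝ) T))
    (continuousOn_iff_continuous_domRestrict.1 h1) (continuousOn_iff_continuous_domRestrict.1 h2) (by
      rintro _ ⟨n, rfl⟩
      simp only [domRestrict_apply]
      rw [← h3 n, h4 n])
  exact domRestrict_eq_domRestrict_iff.1 h

end PathRepresentatives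

/-! ### Estimates for the state problem -/

section StateProblem

variable {d : ℕ} {Ω ΓD ΓC : Set (Eucl d)} {T : ℝ} {A : ℝ → ℝ} {f : ℝ≥0 → ℝ} {L_f : ℝ≥0}
  {α₀ : X Ω ΓC}

theorem exists_isJointRep (w : L2Time T (Xd Ω ΓC)) : ∃ p, IsJointRep w p :=
  exists_joint_measurable (Lp.aestronglyMeasurable w)

theorem IsJointRep.memLp [IsFiniteMeasure (segmentMeasure Ω ΓC)] {w : L2Time T (Xd Ω ΓC)}
    {p : ℝ → Eucl d → Eucl d} (hp : IsJointRep w p) :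
    MemLp (fun z : ℝ × Eucl d => p z.1 z.2) 2
      ((volume.restrict (Icc 0 T)).prod (segmentMeasure Ω ΓC)) :=
  memLp_two_joint hp.1 hp.2

theorem IsJointRep.sub {w z : L2Time T (Xd Ω ΓC)} {p q : ℝ → Eucl d → Eucl d}
    (hp : IsJointRep w p) (hq : IsJointRep z q) :
    IsJointRep (w - z) (fun t x => p t x - q t x) := by
  refine ⟨hp.1.sub hq.1, ?_⟩
  filter_upwards [hp.2, hq.2, Lp.coeFn_sub w z] with t h1 h2 h3
  rw [h3, Pi.sub_apply]
  filter_upwards [h1, h2, Lp.coeFn_sub (w t) (z t)] with x h4 h5 h6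
  rw [h6, Pi.sub_apply, h4, h5]

/-- Dominated by `|f 0| + L_f ‖g‖`, whose constant term is integrable because the measure is finite.
-/
theorem integrable_lipschitz_norm {γ E : Type*} [MeasurableSpace γ] {ρ : Measure γ}
    [IsFiniteMeasure ρ] [NormedAddCommGroup E] (hf : LipschitzWith L_f f) {g : γ → E}
    (hg : Integrable g ρ) : Integrable (fun z => f ‖g z‖₊) ρ := by
  refine ((integrable_const |f 0|).add (hg.norm.const_mul (L_f : ℝ))).mono'
    (hf.continuous.comp_aestronglyMeasurable hg.1.nnnorm) (Eventually.of_forall fun z => ?_)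
  have h := hf.dist_le_mul ‖g z‖₊ 0
  rw [Real.dist_eq, NNReal.dist_eq, NNReal.coe_zero, sub_zero, coe_nnnorm, abs_norm] at h
  simp only [Pi.add_apply, Real.norm_eq_abs]
  linarith [abs_sub_abs_le_abs_sub (f ‖g z‖₊) (f 0)]

theorem IsStateSolution.exists_path [IsFiniteMeasure (segmentMeasure Ω ΓC)] (hA : Monotone A)
    (hAc : Continuous A) (hf : LipschitzWith L_f f) (hT : 0 < T) {v : L2Time T (V Ω ΓD ΓC)}
    {α : C(Icc (0 : ℝ) T, X Ω ΓC)} (hα : IsStateSolution A f α₀ v α)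
    {p : ℝ → Eucl d → Eucl d} (hp : IsJointRep (traceTime v) p) :
    ∃ a, IsPathRep α a ∧ ∀ᵐ x ∂segmentMeasure Ω ΓC,
      IntegrableOn (fun r => f ‖p r x‖₊) (Icc 0 T) ∧
      ∀ s t, 0 ≤ s → s ≤ t → t ≤ T →
        a t x - a s x = ∫ r in s..t, (f ‖p r x‖₊ - A (a r x)) := by
  obtain ⟨-, α', hα', heq⟩ := hα
  have hpt := (ae_restrict_iff' measurableSet_Icc).1 hp.2
  obtain ⟨a, ha, hax⟩ := exists_path_solution hA hAc hT α hα' (F := fun t x => f ‖p t x‖₊)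
    (hf.continuous.measurable.comp hp.1.nnnorm)
    (integrable_lipschitz_norm hf (hp.memLp.integrable (by norm_num))) (by
      filter_upwards [heq, hpt] with t h1 h2 ht
      filter_upwards [h1 ht, h2 ht] with x h3 h4
      rw [h3, h4])
  exact ⟨a, ⟨ha, hax.mono fun x hx => hx.1⟩, hax.mono fun x hx => hx.2⟩

theorem ae_abs_sub_le [IsFiniteMeasure (segmentMeasure Ω ΓC)] (hA : Monotone A)
    (hAc : Continuous A) (hf : LipschitzWith L_f f) (hT : 0 < T) {v w : L2Time T (V Ω ΓD ΓC)}
    {α β : C(Icc (0 : ℝ) T, X Ω ΓC)} (hα : IsStateSolution A f α₀ v α)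
    (hβ : IsStateSolution A f α₀ w β) {a b : ℝ → Eucl d → ℝ} {p q : ℝ → Eucl d → Eucl d}
    (ha : IsPathRep α a) (hb : IsPathRep β b) (hp : IsJointRep (traceTime v) p)
    (hq : IsJointRep (traceTime w) q) :
    ∀ᵐ x ∂segmentMeasure Ω ΓC, IntegrableOn (fun r => p r x - q r x) (Icc 0 T) ∧
      ∀ t ∈ Icc (0 : ℝ) T, ∀ s ∈ Icc (0 : ℝ) t,
        |a s x - b s x| ≤ L_f * ∫ r in (0 : ℝ)..t, ‖p r x - q r x‖ := by
  obtain ⟨a', ha', hax'⟩ := hα.exists_path hA hAc hf hT hp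
  obtain ⟨b', hb', hbx'⟩ := hβ.exists_path hA hAc hf hT hq
  have ha0 := ha.1 ⟨0, le_rfl, hT.le⟩
  have hb0 := hb.1 ⟨0, le_rfl, hT.le⟩
  rw [hα.1 _ rfl] at ha0
  rw [hβ.1 _ rfl] at hb0
  filter_upwards [ae_eqOn_of_path_representatives hT ha.1 ha'.1 ha.2 ha'.2,
    ae_eqOn_of_path_representatives hT hb.1 hb'.1 hb.2 hb'.2, ha'.2, hb'.2, hax', hbx', ha0, hb0,
    ((hp.sub hq).memLp.integrable (by norm_num)).prod_left_ae]
    with x ea eb ca cb ⟨iF, da⟩ ⟨iG, db⟩ a0 b0 ipq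
  refine ⟨ipq, fun t ht s hs => ?_⟩
  have hsT : s ≤ T := hs.2.trans ht.2
  have hsub : Icc 0 s ⊆ Icc 0 T := Icc_subset_Icc_right hsT
  have hii {u : ℝ → ℝ} (hu : IntegrableOn u (Icc 0 T)) {t : ℝ} (h0 : 0 ≤ t) (ht : t ≤ T) :
      IntervalIntegrable u volume 0 t :=
    (intervalIntegrable_iff_integrableOn_Icc_of_le h0).2
      (hu.mono_set (Icc_subset_Icc_right ht))
  have h1 := abs_sub_le_of_monotone_equation hA hAc hs.1 (ca.mono hsub) (cb.mono hsub)
    (hii iF hs.1 hsT) (hii iG hs.1 hsT) (fun r hr => da r s hr.1 hr.2 hsT)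
    (fun r hr => db r s hr.1 hr.2 hsT)
  have hmem0 : (0 : ℝ) ∈ Icc 0 T := ⟨le_rfl, hT.le⟩
  -- The common initial state removes the initial term of the comparison estimate.
  have h2 : a' 0 x - b' 0 x = 0 := by
    rw [sub_eq_zero, ← show a 0 x = a' 0 x from ea hmem0, ← show b 0 x = b' 0 x from eb hmem0]
    exact a0.symm.trans b0
  have ea' : a s x = a' s x := ea ⟨hs.1, hsT⟩
  have eb' : b s x = b' s x := eb ⟨hs.1, hsT⟩
  rw [h2, abs_zero, zero_add, ← ea', ← eb'] at h1
  refine h1.trans ?_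
  rw [← intervalIntegral.integral_const_mul]
  calc ∫ r in (0 : ℝ)..s, |f ‖p r x‖₊ - f ‖q r x‖₊|
      ≤ ∫ r in (0 : ℝ)..s, L_f * ‖p r x - q r x‖ := by
        refine intervalIntegral.integral_mono_on hs.1
          ((hii iF hs.1 hsT).sub (hii iG hs.1 hsT)).abs
          (hii (ipq.norm.const_mul _) hs.1 hsT) fun r _ => ?_
        have h := hf.dist_le_mul ‖p r x‖₊ ‖q r x‖₊
        rw [Real.dist_eq, NNReal.dist_eq] at h
        exact h.trans (mul_le_mul_of_nonneg_left (abs_norm_sub_norm_le _ _) L_f.2)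
    _ ≤ ∫ r in (0 : ℝ)..t, L_f * ‖p r x - q r x‖ :=
        intervalIntegral.integral_mono_interval le_rfl hs.1 hs.2
          (Eventually.of_forall fun _ => by positivity)
          (hii (ipq.norm.const_mul _) ht.1 ht.2)

/-- Cauchy–Schwarz against the constant `1` on `[0, T]`; this is the source of the factor `√T`. -/
theorem enorm_integral_sq_le {E : Type*} [NormedAddCommGroup E] (hT : 0 ≤ T) {g : ℝ → E}
    (hg : AEStronglyMeasurable g (volume.restrict (Icc 0 T))) :
    ‖∫ r in (0 : ℝ)..T, ‖g r‖‖ₑ ^ 2 ≤ ENNReal.ofReal T * ∫⁻ r in Icc 0 T, ‖g r‖ₑ ^ 2 := by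
  have h1 : ‖∫ r in (0 : ℝ)..T, ‖g r‖‖ₑ ≤ eLpNorm g 1 (volume.restrict (Icc 0 T)) := by
    rw [intervalIntegral.integral_of_le hT, ← integral_Icc_eq_integral_Ioc,
      eLpNorm_one_eq_lintegral_enorm]
    refine (enorm_integral_le_lintegral_enorm _).trans_eq ?_
    simp
  have h2 := eLpNorm_le_eLpNorm_mul_rpow_measure_univ (p := 1) (q := 2) (by norm_num) hg
  have h3 : (volume.restrict (Icc 0 T) univ ^
      (1 / (1 : ℝ≥0∞).toReal - 1 / (2 : ℝ≥0∞).toReal)) ^ 2 = ENNReal.ofReal T := by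
    rw [← ENNReal.rpow_natCast, ← ENNReal.rpow_mul]
    norm_num
  calc _ ≤ (eLpNorm g 2 (volume.restrict (Icc 0 T)) * (volume.restrict (Icc 0 T) univ) ^
        (1 / (1 : ℝ≥0∞).toReal - 1 / (2 : ℝ≥0∞).toReal)) ^ 2 := by gcongr; exact h1.trans h2
    _ = _ := by rw [mul_pow, h3, eLpNorm_two_eq_lintegral, mul_comm]

theorem norm_sub_le_of_isStateSolution [IsFiniteMeasure (segmentMeasure Ω ΓC)] (hA : Monotone A)
    (hAc : Continuous A) (hf : LipschitzWith L_f f) (hT : 0 < T) {v w : L2Time T (V Ω ΓD ΓC)}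
    {α β : C(Icc (0 : ℝ) T, X Ω ΓC)} (hα : IsStateSolution A f α₀ v α)
    (hβ : IsStateSolution A f α₀ w β) :
    ‖α - β‖ ≤ √T * L_f * ‖traceTime v - traceTime w‖ := by
  obtain ⟨p, hp⟩ := exists_isJointRep (traceTime v)
  obtain ⟨q, hq⟩ := exists_isJointRep (traceTime w)
  obtain ⟨a, ha, -⟩ := hα.exists_path hA hAc hf hT hp
  obtain ⟨b, hb, -⟩ := hβ.exists_path hA hAc hf hT hq
  have hpq := hp.sub hq
  have hest := ae_abs_sub_le hA hAc hf hT hα hβ ha hb hp hq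
  refine (ContinuousMap.norm_le _ (by positivity)).2 fun t => ?_
  set N := ‖traceTime v - traceTime w‖ with hN
  have hmeas : Measurable fun z : ℝ × Eucl d => ‖p z.1 z.2 - q z.1 z.2‖ₑ ^ 2 := by
    have := hpq.1
    fun_prop
  have key : ‖(α - β) t‖ₑ ^ 2 ≤ ENNReal.ofReal (√T * L_f * N) ^ 2 := by
    rw [Lp.enorm_def, eLpNorm_two_eq_lintegral]
    calc ∫⁻ x, ‖(α - β) t x‖ₑ ^ 2 ∂segmentMeasure Ω ΓC
        ≤ ∫⁻ x, (ENNReal.ofNNReal L_f ^ 2 * ENNReal.ofReal T) *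
            (∫⁻ r in Icc 0 T, ‖p r x - q r x‖ₑ ^ 2) ∂segmentMeasure Ω ΓC := by
          refine lintegral_mono_ae ?_
          filter_upwards [hest, ha.1 t, hb.1 t, Lp.coeFn_sub (α t) (β t)] with x ⟨h1, h2⟩ h3 h4 h5
          have h6 : ‖(α - β) t x‖ₑ ≤ L_f * ‖∫ r in (0 : ℝ)..T, ‖p r x - q r x‖‖ₑ := by
            rw [ContinuousMap.sub_apply, h5, Pi.sub_apply, h3, h4]
            -- The right end is taken to be `T`, so that the bound is the same for every evaluation
            -- time `t`.
            have h7 := h2 T ⟨hT.le, le_rfl⟩ t t.2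
            have h8 : ‖a t x - b t x‖ ≤ ‖(L_f : ℝ) * ∫ r in (0 : ℝ)..T, ‖p r x - q r x‖‖ :=
              h7.trans (le_abs_self _)
            have h9 := enorm_le_iff_norm_le.2 h8
            rwa [enorm_mul, NNReal.enorm_eq] at h9
          calc _ ≤ (L_f * ‖∫ r in (0 : ℝ)..T, ‖p r x - q r x‖‖ₑ) ^ 2 := by gcongr
            _ = ENNReal.ofNNReal L_f ^ 2 * ‖∫ r in (0 : ℝ)..T, ‖p r x - q r x‖‖ₑ ^ 2 := mul_pow ..
            _ ≤ ENNReal.ofNNReal L_f ^ 2 * (ENNReal.ofReal T *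
                ∫⁻ r in Icc 0 T, ‖p r x - q r x‖ₑ ^ 2) := by
              gcongr
              exact enorm_integral_sq_le hT.le h1.1
            _ = _ := (mul_assoc ..).symm
      _ = (ENNReal.ofNNReal L_f ^ 2 * ENNReal.ofReal T) * ‖traceTime v - traceTime w‖ₑ ^ 2 := by
          rw [lintegral_const_mul' _ _ (by finiteness), ← lintegral_joint_sq hpq.2,
            lintegral_lintegral_swap]
          exact (hmeas.comp measurable_swap).aemeasurable
      _ = ENNReal.ofReal (√T * L_f * N) ^ 2 := by
          rw [← ofReal_norm, ← hN, ← ENNReal.ofReal_coe_nnreal,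
            ← ENNReal.ofReal_pow (by positivity), ← ENNReal.ofReal_pow (by positivity),
            ← ENNReal.ofReal_mul (by positivity), ← ENNReal.ofReal_mul (by positivity),
            ← ENNReal.ofReal_pow (by positivity), mul_pow, mul_pow, Real.sq_sqrt hT.le]
          ring_nf
  have h1 := (ENNReal.pow_le_pow_left_iff two_ne_zero).1 key
  rwa [← ofReal_norm, ENNReal.ofReal_le_ofReal_iff (by positivity)] at h1

theorem norm_traceTime_sub_le (v w : L2Time T (V Ω ΓD ΓC)) :
    ‖traceTime v - traceTime w‖ ≤ ‖contactTrace Ω ΓD ΓC‖ * ‖v - w‖ := by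
  have h : traceTime v - traceTime w = traceTime (v - w) :=
    (((contactTrace Ω ΓD ΓC).compLpL 2 (volume.restrict (Icc (0 : ℝ) T))).map_sub v w).symm
  rw [h]
  exact ContinuousLinearMap.norm_compLp_le _ _

end StateProblem

end RateState

open RateState in
theorem mainTheorem4 {d : ℕ} (Ω ΓD ΓC : Set (Eucl d))
    (hΩo : IsOpen Ω) (hΩb : Bornology.IsBounded Ω) (hΩL : HasLipschitzBoundary Ω)
    (hD : MeasurableSet ΓD) (hDΓ : ΓD ⊆ frontier Ω)
    (hC : MeasurableSet ΓC) (hCΓ : ΓC ⊆ frontier Ω)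
    (A : ℝ → ℝ) (hA : Monotone A) (hAc : Continuous A)
    (f : ℝ≥0 → ℝ) (L_f : ℝ≥0) (hf : LipschitzWith L_f f)
    (T : ℝ) (hT : 0 < T) (α₀ : X Ω ΓC) :
    (∀ (u' w' : L2Time T (V Ω ΓD ΓC)) (α β : C(Icc (0 : ℝ) T, X Ω ΓC)),
      IsStateSolution A f α₀ u' α → IsStateSolution A f α₀ w' β →
      ((∃ a, IsPathRep α a) ∧ (∃ b, IsPathRep β b) ∧
        (∃ p, IsJointRep (traceTime u') p) ∧ (∃ q, IsJointRep (traceTime w') q) ∧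
        ∀ a b p q, IsPathRep α a → IsPathRep β b →
          IsJointRep (traceTime u') p → IsJointRep (traceTime w') q →
          ∀ᵐ x ∂segmentMeasure Ω ΓC,
            IntegrableOn (fun r => p r x - q r x) (Icc 0 T) ∧
            ∀ t ∈ Icc (0 : ℝ) T, ∀ s ∈ Icc (0 : ℝ) t,
              |a s x - b s x| ≤ L_f * ∫ r in (0 : ℝ)..t, ‖p r x - q r x‖) ∧
      ‖α - β‖ ≤ √T * L_f * ‖traceTime u' - traceTime w'‖) ∧
    ∀ (D : Set (L2Time T (V Ω ΓD ΓC))) (S : L2Time T (V Ω ΓD ΓC) → C(Icc (0 : ℝ) T, X Ω ΓC)),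
      (∀ v ∈ D, IsStateSolution A f α₀ v (S v)) →
      LipschitzOnWith (Real.toNNReal (√T * ‖contactTrace Ω ΓD ΓC‖ * L_f)) S D := by
  have := isFiniteMeasure_segmentMeasure hΩo hΩb hΩL ΓC
  refine ⟨fun u' w' α β hα hβ => ⟨?_, norm_sub_le_of_isStateSolution hA hAc hf hT hα hβ⟩,
    fun D S hS => LipschitzOnWith.of_dist_le_mul fun v hv w hw => ?_⟩
  · obtain ⟨p, hp⟩ := exists_isJointRep (traceTime u')
    obtain ⟨q, hq⟩ := exists_isJointRep (traceTime w')
    obtain ⟨a, ha, -⟩ := hα.exists_path hA hAc hf hT hp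
    obtain ⟨b, hb, -⟩ := hβ.exists_path hA hAc hf hT hq
    exact ⟨⟨a, ha⟩, ⟨b, hb⟩, ⟨p, hp⟩, ⟨q, hq⟩, fun a b p q ha hb hp hq =>
      ae_abs_sub_le hA hAc hf hT hα hβ ha hb hp hq⟩
  · rw [dist_eq_norm, dist_eq_norm, Real.coe_toNNReal _ (by positivity)]
    calc ‖S v - S w‖ ≤ √T * L_f * ‖traceTime v - traceTime w‖ :=
          norm_sub_le_of_isStateSolution hA hAc hf hT (hS v hv) (hS w hw)
      _ ≤ √T * L_f * (‖contactTrace Ω ΓD ΓC‖ * ‖v - w‖) := by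
          gcongr
          exact norm_traceTime_sub_le v w
      _ = √T * ‖contactTrace Ω ΓD ΓC‖ * L_f * ‖v - w‖ := by ring
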